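/- Let $K\ge 0$, $\mu\in\mathbb R^2$, $\alpha_k=(\alpha_{kij})\in\mathbb R^{2\times 2}$ and $\beta_{k1},\beta_{k2}>0$ for $k=1,\dots,K$. Let $N=(N_1,N_2)$ be a bivariate multi-kernel Hawkes process on the whole real line: $N_1,N_2$ are simple, locally finite counting processes, adapted to a filtration $(\mathcal F_t)_{t\in\mathbb R}$, almost surely without common jumps, and the non-negative process $$\lambda_t=\mu+\sum_{k=1}^K\lambda_k(t),\qquad \lambda_k(t)=\int_{(-\infty,t)}h_k(t-u)\,\mathrm dN_u,\qquad (h_k(t))_{ij}=\alpha_{kij}\,e^{-\beta_{ki}t},$$ (the integrals being almost surely convergent) is the $(\mathcal F_t)$-intensity of $N$, that is, $\mathbb E\int_{\mathbb R} C_t\,\mathrm dN_j(t)=\mathbb E\int_{\mathbb R} C_t\lambda_j(t)\,\mathrm dt$ for $j=1,2$ and every non-negative predictable process $C$. Put $$\Lambda_t=\begin{bmatrix}\lambda_1(t)\\ \vdots\\ \lambda_K(t)\end{bmatrix}\in\mathbb R^{2K},\quad \alpha=\begin{bmatrix}\alpha_1\\ \vdots\\ \alpha_K\end{bmatrix}\in\mathbb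 R^{2K\times 2},\quad \beta=\mathrm{Dg}(\beta_{11},\beta_{12},\dots,\beta_{K1},\beta_{K2}),\quad J=[\,I_2\ \cdots\ I_2\,]\in\mathbb R^{2\times 2K},$$ where $\mathrm{Dg}(\cdot)$ is the diagonal matrix with the given diagonal. Assume that the process is in a steady state, that is, the law of $\Lambda_t$ does not depend on $t\in\mathbb R$, and that $\Lambda_t$ is square integrable, so that $\mathbb E[\Lambda_t\Lambda_t^\top]$ exists. Then for every $t\in\mathbb R$ the matrix $\mathbb E[\Lambda_t\Lambda_t^\top]$ satisfies the Sylvester equation $$(\beta-\alpha J)\,\mathbb E[\Lambda_t\Lambda_t^\top]+\mathbb E[\Lambda_t\Lambda_t^\top]\,(\beta-J^\top\alpha^\top)=R_t,\qquad R_t=\alpha\mu\,\mathbb E[\Lambda_t^\top]+\mathbb E[\Lambda_t]\,\mu^\top\alpha^\top+\alpha\,\mathrm{Dg}(\mathbb E[\lambda_t])\,\alpha^\top.$$ Equivalently, it satisfies the linear system $$\bigl(I\otimes(\beta-\alpha J)+(\beta-\alpha J)\otimes I\bigr)\,\mathrm{vec}\bigl(\mathbb E[\Lambda_t\Lambda_t^\top]\bigr)=\mathrm{vec}(R_t),$$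 where $\otimes$ is the Kronecker product and $\mathrm{vec}$ stacks the columns of a matrix; more generally, a matrix $X\in\mathbb R^{2K\times 2K}$ solves $(\beta-\alpha J)X+X(\beta-J^\top\alpha^\top)=R_t$ if and only if $\bigl(I\otimes(\beta-\alpha J)+(\beta-\alpha J)\otimes I\bigr)\mathrm{vec}(X)=\mathrm{vec}(R_t)$. -/

import Mathlib

open MeasureTheory ProbabilityTheory
open scoped ENNReal Matrix Kronecker

namespace MultiKernelHawkes

noncomputable section

/-- The predictable σ-algebra on `ℝ × Ω` of a filtration indexed by the whole real line: it is
generated by the sets `(s, ∞) × A` with `A ∈ ℱ s`. -/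
@[reducible]
def predictable {Ω : Type*} {m : MeasurableSpace Ω} (ℱ : Filtration ℝ m) :
    MeasurableSpace (ℝ × Ω) :=
  MeasurableSpace.generateFrom
    {S | ∃ (s : ℝ) (A : Set Ω), MeasurableSet[ℱ s] A ∧ S = Set.Ioi s ×ˢ A}

/-- The counting measure of the jump times: if `T j ω` is the set of jump times of the `j`-th
component, then `counting T j ω B` is the number of jumps in `B`, so that integration against it
is integration against `dN_j`, and `N_j(t) - N_j(s) = counting T j ω (Set.Ioc s t)`. -/
def counting {Ω : Type*} (T : Fin 2 → Ω → Set ℝ) (j : Fin 2) (ω : Ω) : Measure ℝ :=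
  Measure.count.restrict (T j ω)

/-- The `k`-th kernel `h_k(t)`, with entries `α_{kij} exp (-β_{ki} t)`. -/
def kernel {K : ℕ} (α : Fin K → Matrix (Fin 2) (Fin 2) ℝ) (β : Fin K → Fin 2 → ℝ)
    (k : Fin K) (t : ℝ) : Matrix (Fin 2) (Fin 2) ℝ :=
  α k ⊙ Matrix.of fun i _ => Real.exp (-(β k i) * t)

/-- The stacked vector `Λ_t` with the entries
`λ_{ki}(t) = ∑_j ∫_{(-∞, t)} (h_k)_{ij}(t - u) dN_j(u)`, indexed by the pairs `(k, i)`. -/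
def stacked {Ω : Type*} {K : ℕ} (α : Fin K → Matrix (Fin 2) (Fin 2) ℝ)
    (β : Fin K → Fin 2 → ℝ) (T : Fin 2 → Ω → Set ℝ) (t : ℝ) (ω : Ω) : Fin K × Fin 2 → ℝ :=
  fun p => ∑ j, ∫ u in Set.Iio t, kernel α β p.1 (t - u) p.2 j ∂(counting T j ω)

/-- The intensity `λ_t = μ + ∑_k λ_k(t)`. -/
def intensity {Ω : Type*} {K : ℕ} (μ : Fin 2 → ℝ) (α : Fin K → Matrix (Fin 2) (Fin 2) ℝ)
    (β : Fin K → Fin 2 → ℝ) (T : Fin 2 → Ω → Set ℝ) (t : ℝ) (ω : Ω) : Fin 2 → ℝ :=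
  fun i => μ i + ∑ k, stacked α β T t ω (k, i)

/-- `T 0 ω` and `T 1 ω` are the sets of jump times of a bivariate multi-kernel Hawkes process on
the real line with base rate `μ` and kernels `h_k`, relative to the filtration `ℱ`. -/
structure IsHawkes {Ω : Type*} {m : MeasurableSpace Ω} {K : ℕ} (P : Measure Ω)
    (ℱ : Filtration ℝ m) (μ : Fin 2 → ℝ) (α : Fin K → Matrix (Fin 2) (Fin 2) ℝ)
    (β : Fin K → Fin 2 → ℝ) (T : Fin 2 → Ω → Set ℝ) : Prop where
  /-- There are finitely many jumps in every bounded time interval. -/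
  locallyFinite : ∀ j ω a b, (T j ω ∩ Set.Icc a b).Finite
  /-- The two components almost surely have no common jump. -/
  noCommonJumps : ∀ᵐ ω ∂P, Disjoint (T 0 ω) (T 1 ω)
  /-- The increments of the counting processes are adapted. -/
  adapted : ∀ j s t, Measurable[ℱ t] fun ω => counting T j ω (Set.Ioc s t)
  /-- The integrals that define the components of the intensity converge almost surely. -/
  integrable : ∀ᵐ ω ∂P, ∀ t k i j,
    IntegrableOn (fun u => kernel α β k (t - u) i j) (Set.Iio t) (counting T j ω)
  /-- The intensity is non-negative. -/
  nonneg : ∀ᵐ ω ∂P, ∀ t i, 0 ≤ intensity μ α β T t ω i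
  /-- `λ_j` is the stochastic intensity of `N_j`: `E ∫ C_t dN_j(t) = E ∫ C_t λ_j(t) dt` for all
  non-negative predictable processes `C`. -/
  isIntensity : ∀ (j : Fin 2) (C : ℝ × Ω → ℝ≥0∞), Measurable[predictable ℱ] C →
    ∫⁻ ω, ∫⁻ t, C (t, ω) ∂(counting T j ω) ∂P =
      ∫⁻ ω, ∫⁻ t, C (t, ω) * ENNReal.ofReal (intensity μ α β T t ω j) ∂volume ∂P

/-- Steady state: the law of `Λ_t` does not depend on `t`. -/
def IsSteadyState {Ω : Type*} {m : MeasurableSpace Ω} {K : ℕ} (P : Measure Ω)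
    (α : Fin K → Matrix (Fin 2) (Fin 2) ℝ) (β : Fin K → Fin 2 → ℝ)
    (T : Fin 2 → Ω → Set ℝ) : Prop :=
  ∀ t, IdentDistrib (stacked α β T t) (stacked α β T 0) P P

/-- The `2K × 2` matrix with the blocks `α_1, …, α_K`. -/
def stackedAlpha {K : ℕ} (α : Fin K → Matrix (Fin 2) (Fin 2) ℝ) :
    Matrix (Fin K × Fin 2) (Fin 2) ℝ :=
  Matrix.of fun p j => α p.1 p.2 j

/-- The diagonal `2K × 2K` matrix of the decay rates `β_{ki}`. -/
def stackedBeta {K : ℕ} (β : Fin K → Fin 2 → ℝ) :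
    Matrix (Fin K × Fin 2) (Fin K × Fin 2) ℝ :=
  Matrix.diagonal fun p => β p.1 p.2

/-- The `2 × 2K` matrix `J = [I ⋯ I]`. -/
def matJ (K : ℕ) : Matrix (Fin 2) (Fin K × Fin 2) ℝ :=
  Matrix.of fun i p => if i = p.2 then 1 else 0

/-- The vector `E[X]`. -/
def mean {Ω ι : Type*} {m : MeasurableSpace Ω} (P : Measure Ω) (X : Ω → ι → ℝ) : ι → ℝ :=
  fun p => ∫ ω, X ω p ∂P

/-- The matrix `E[X Xᵀ]`. -/
def secondMoment {Ω ι : Type*} {m : MeasurableSpace Ω} (P : Measure Ω) (X : Ω → ι → ℝ) :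
    Matrix ι ι ℝ :=
  Matrix.of fun p q => ∫ ω, X ω p * X ω q ∂P

/-- The right-hand side `α μ E[Λᵀ] + E[Λ] μᵀ αᵀ + α Dg(E[λ]) αᵀ`. -/
def rhs {Ω : Type*} {m : MeasurableSpace Ω} {K : ℕ} (P : Measure Ω)
    (μ : Fin 2 → ℝ) (α : Fin K → Matrix (Fin 2) (Fin 2) ℝ)
    (β : Fin K → Fin 2 → ℝ) (T : Fin 2 → Ω → Set ℝ) (t : ℝ) :
    Matrix (Fin K × Fin 2) (Fin K × Fin 2) ℝ :=
  stackedAlpha α * Matrix.vecMulVec μ (mean P (stacked α β T t))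
    + Matrix.vecMulVec (mean P (stacked α β T t)) μ * (stackedAlpha α)ᵀ
    + stackedAlpha α * Matrix.diagonal (mean P (intensity μ α β T t)) * (stackedAlpha α)ᵀ

end

end MultiKernelHawkes

/-!
Let `p`, `q` be components of `Λ`, with decay rates `β_p`, `β_q`. Between jumps `Λ_p Λ_q` decays at
the rate `β_p + β_q`, and at a jump of `N_l` it increases by an affine function `productJump_l` of
the left limit of `Λ`. Since there are no common jumps, integration by parts on `(-∞, t)` gives
`Λ_p(t) Λ_q(t) = ∑_l ∫_{(-∞, t)} exp (-(β_p + β_q) (t - w)) productJump_l (Λ_w) dN_l(w)`.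
The left limit `Λ_w` is predictable, so in expectation `dN_l(w)` can be replaced by `λ_l(w) dw`; as
the law of `Λ_w` is constant, the exponential integrates to `(β_p + β_q)⁻¹` and
`(β_p + β_q) E[Λ_p Λ_q] = ∑_l E[productJump_l (Λ) λ_l]`. Substituting `λ = μ + J Λ` on the right
gives the Sylvester equation.
-/

namespace MultiKernelHawkes

open Set Filter Topology
open scoped NNReal

section RandomMeasure

variable {Ω E : Type*} {mΩ : MeasurableSpace Ω} {mE : MeasurableSpace E}

lemma sum_restrict_Ioc_intCast (ν : Measure ℝ) :
    Measure.sum (fun k : ℤ => ν.restrict (Ioc (k : ℝ) (k + 1))) = ν := by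
  rw [← Measure.restrict_iUnion (pairwise_disjoint_Ioc_intCast ℝ) fun _ => measurableSet_Ioc,
    iUnion_Ioc_intCast, Measure.restrict_univ]

lemma measurable_measure_of_measurable_Ioc {n : Ω → Measure ℝ} [∀ ω, IsLocallyFiniteMeasure (n ω)]
    (h : ∀ s r, Measurable fun ω => n ω (Ioc s r)) : Measurable n := by
  have hpiece (k : ℤ) : Measurable fun ω => (n ω).restrict (Ioc (k : ℝ) (k + 1)) := by
    have (ω : Ω) : IsFiniteMeasure ((n ω).restrict (Ioc (k : ℝ) (k + 1))) :=
      isFiniteMeasure_restrict.2 measure_Ioc_lt_top.ne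
    refine Measurable.measure_of_isPiSystem
      (BorelSpace.measurable_eq.trans (borel_eq_generateFrom_Ioc ℝ)) (isPiSystem_Ioc id id) ?_
      (by simpa only [Measure.restrict_apply_univ] using h _ _)
    rintro _ ⟨s, r, -, rfl⟩
    simp only [Measure.restrict_apply measurableSet_Ioc, Ioc_inter_Ioc]
    exact h _ _
  refine Measure.measurable_of_measurable_coe _ fun A hA => ?_
  simp_rw [← fun ω => congrArg (· A) (sum_restrict_Ioc_intCast (n ω)), Measure.sum_apply _ hA]
  exact .tsum fun k => (Measure.measurable_coe hA).comp (hpiece k)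

-- The total masses need not be bounded, so the kernel is a density times its normalization.
lemma isSFiniteKernel_of_isFiniteMeasure (κ : Kernel Ω E) [∀ ω, IsFiniteMeasure (κ ω)] :
    IsSFiniteKernel κ := by
  have hmass : Measurable fun ω => κ ω univ := κ.measurable_coe .univ
  let η : Kernel Ω E := ⟨fun ω => (κ ω univ)⁻¹ • κ ω,
    Measure.measurable_of_measurable_coe _ fun s hs => hmass.inv.mul (κ.measurable_coe hs)⟩
  have hη : IsFiniteKernel η :=
    ⟨⟨1, ENNReal.one_lt_top, fun ω => ENNReal.inv_mul_le_one (κ ω univ)⟩⟩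
  have hdensity : Measurable (Function.uncurry fun ω (_ : E) => κ ω univ) :=
    hmass.comp measurable_fst
  have hκ : κ = η.withDensity fun ω _ => κ ω univ := by
    ext1 ω
    rw [Kernel.withDensity_apply _ hdensity, withDensity_const]
    change κ ω = κ ω univ • (κ ω univ)⁻¹ • κ ω
    rcases eq_or_ne (κ ω) 0 with h | h
    · simp [h]
    · rw [smul_smul, ENNReal.mul_inv_cancel (by simpa using h) (measure_ne_top _ _), one_smul]
  rw [hκ]
  exact Kernel.isSFiniteKernel_withDensity_of_isFiniteKernel η fun ω _ => measure_ne_top (κ ω) _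

lemma isSFiniteKernel_of_isLocallyFiniteMeasure (κ : Kernel Ω ℝ)
    [∀ ω, IsLocallyFiniteMeasure (κ ω)] : IsSFiniteKernel κ := by
  have hκ : κ = Kernel.sum fun k : ℤ =>
      κ.restrict (measurableSet_Ioc : MeasurableSet (Ioc (k : ℝ) (k + 1))) := by
    ext1 ω
    simp only [Kernel.sum_apply, Kernel.restrict_apply, sum_restrict_Ioc_intCast]
  have (k : ℤ) : IsSFiniteKernel
      (κ.restrict (measurableSet_Ioc : MeasurableSet (Ioc (k : ℝ) (k + 1)))) := by
    have (ω : Ω) : IsFiniteMeasure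
        (κ.restrict (measurableSet_Ioc : MeasurableSet (Ioc (k : ℝ) (k + 1))) ω) := by
      rw [Kernel.restrict_apply]
      exact isFiniteMeasure_restrict.2 measure_Ioc_lt_top.ne
    exact isSFiniteKernel_of_isFiniteMeasure _
  rw [hκ]
  exact Kernel.isSFiniteKernel_sum

end RandomMeasure

section Predictable

variable {Ω : Type*} {mΩ : MeasurableSpace Ω} {ℱ : Filtration ℝ mΩ}

lemma predictable_le_prod : predictable ℱ ≤ (inferInstance : MeasurableSpace (ℝ × Ω)) := by
  refine MeasurableSpace.generateFrom_le ?_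
  rintro _ ⟨s, A, hA, rfl⟩
  exact measurableSet_Ioi.prod (ℱ.le s A hA)

lemma measurable_fst_predictable : Measurable[predictable ℱ] (Prod.fst : ℝ × Ω → ℝ) := by
  refine @measurable_of_Ioi ℝ (ℝ × Ω) _ _ _ (predictable ℱ) _ _ _ _ fun s => ?_
  exact MeasurableSpace.measurableSet_generateFrom ⟨s, univ, MeasurableSet.univ, by ext; simp⟩

lemma measurable_predictable_of_monotone_of_leftContinuous {R : Type*} [TopologicalSpace R]
    [SecondCountableTopology R] [LinearOrder R] [OrderTopology R] [MeasurableSpace R]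
    [BorelSpace R] {X : ℝ → Ω → R} (hadapted : ∀ r, Measurable[ℱ r] (X r))
    (hmono : ∀ ω, Monotone fun r => X r ω)
    (hleft : ∀ ω u, ContinuousWithinAt (fun r => X r ω) (Iio u) u) :
    Measurable[predictable ℱ] fun z : ℝ × Ω => X z.1 z.2 := by
  refine @measurable_of_Ioi R (ℝ × Ω) _ _ _ (predictable ℱ) _ _ _ _ fun c => ?_
  have hpreimage : (fun z : ℝ × Ω => X z.1 z.2) ⁻¹' Ioi c
      = ⋃ r : ℚ, Ioi (r : ℝ) ×ˢ {ω | c < X r ω} := by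
    ext ⟨u, ω⟩
    simp only [mem_preimage, mem_Ioi, mem_iUnion, mem_prod, mem_ofPred_eq]
    refine ⟨fun hc => ?_, fun ⟨r, hru, hc⟩ => hc.trans_le (hmono ω hru.le)⟩
    obtain ⟨l, hlu, hl⟩ := mem_nhdsLT_iff_exists_Ioo_subset.1 ((hleft ω u).eventually_const_lt hc)
    obtain ⟨r, hlr, hru⟩ := exists_rat_btwn (mem_Iio.1 hlu)
    exact ⟨r, hru, hl ⟨hlr, hru⟩⟩
  rw [hpreimage]
  exact @MeasurableSet.iUnion _ _ (predictable ℱ) _ _ fun r =>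
    MeasurableSpace.measurableSet_generateFrom ⟨r, _, hadapted r measurableSet_Ioi, rfl⟩

lemma continuousWithinAt_measure_Iio (ν : Measure ℝ) (u : ℝ) :
    ContinuousWithinAt (fun r => ν (Iio r)) (Iio u) u := by
  have hmono : Monotone fun r => ν (Iio r) := fun _ _ h => measure_mono (Iio_subset_Iio h)
  obtain ⟨s, hs, hsu, hlim⟩ := exists_seq_strictMono_tendsto u
  have hunion : ⋃ k, Iio (s k) = Iio u := by
    ext v
    simp only [mem_iUnion, mem_Iio]
    exact ⟨fun ⟨k, hk⟩ => hk.trans (hsu k), fun hv => (hlim.eventually_const_lt hv).exists⟩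
  have hseq : Tendsto (fun k => ν (Iio (s k))) atTop (𝓝 (ν (Iio u))) := by
    rw [← hunion]
    exact tendsto_measure_iUnion_atTop fun _ _ h => Iio_subset_Iio (hs.monotone h)
  have hleft := hmono.tendsto_nhdsLT u
  have hsu' : Tendsto s atTop (𝓝[<] u) := tendsto_nhdsWithin_iff.2 ⟨hlim, .of_forall hsu⟩
  rwa [tendsto_nhds_unique (hleft.comp hsu') hseq] at hleft

lemma measurable_setLIntegral_Iio_predictable {n : Ω → Measure ℝ}
    [∀ ω, IsLocallyFiniteMeasure (n ω)] (h : ∀ s r, Measurable[ℱ r] fun ω => n ω (Ioc s r))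
    {g : ℝ → ℝ≥0∞} (hg : Measurable g) :
    Measurable[predictable ℱ] fun z : ℝ × Ω => ∫⁻ v in Iio z.1, g v ∂n z.2 := by
  refine measurable_predictable_of_monotone_of_leftContinuous
    (X := fun r ω => ∫⁻ v in Iio r, g v ∂n ω) (fun r => ?_)
    (fun ω _ _ hr => lintegral_mono_set (Iio_subset_Iio hr)) fun ω u => ?_
  · have hrestrict : Measurable[ℱ r] fun ω => (n ω).restrict (Iic r) := by
      refine @measurable_measure_of_measurable_Ioc _ (ℱ r) _ _ fun s q => ?_
      simp only [Measure.restrict_apply measurableSet_Ioc, Ioc_inter_Iic]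
      exact (h s (min q r)).mono (ℱ.mono (min_le_right q r)) le_rfl
    have hIio (ω : Ω) : ∫⁻ v in Iio r, g v ∂n ω
        = ∫⁻ v, (Iio r).indicator g v ∂(n ω).restrict (Iic r) := by
      rw [lintegral_indicator measurableSet_Iio, Measure.restrict_restrict measurableSet_Iio,
        inter_eq_left.2 Iio_subset_Iic_self]
    simp_rw [hIio]
    exact (Measure.measurable_lintegral (hg.indicator measurableSet_Iio)).comp hrestrict
  · simp_rw [← withDensity_apply g measurableSet_Iio]
    exact continuousWithinAt_measure_Iio _ u

end Predictable

section IntegrationByParts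

variable {E F 𝕜 : Type*} {mE : MeasurableSpace E} {mF : MeasurableSpace F} [RCLike 𝕜]

lemma indicator_prodMk_right_mul (S : Set (E × F)) (f : E → 𝕜) (g : F → 𝕜) (v : E) (w : F) :
    S.indicator (fun z => f z.1 * g z.2) (v, w)
      = ((·, w) ⁻¹' S).indicator (fun v => f v) v * g w := by
  by_cases h : (v, w) ∈ S <;> simp [h]

variable {ν₁ : Measure E} {ν₂ : Measure F} [SFinite ν₁] [SFinite ν₂] {S : Set (E × F)}
  {f : E → 𝕜} {g : F → 𝕜}

lemma integrable_setIntegral_section_mul (hS : MeasurableSet S) (hf : Integrable f ν₁)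
    (hg : Integrable g ν₂) :
    Integrable (fun w => (∫ v in (·, w) ⁻¹' S, f v ∂ν₁) * g w) ν₂ := by
  have h := ((hf.mul_prod hg).indicator hS).integral_prod_right
  simpa only [indicator_prodMk_right_mul, integral_mul_const,
    integral_indicator (measurable_prodMk_right hS)] using h

lemma setIntegral_prod_mul_eq_integral_section (hS : MeasurableSet S) (hf : Integrable f ν₁)
    (hg : Integrable g ν₂) :
    ∫ z in S, f z.1 * g z.2 ∂ν₁.prod ν₂ = ∫ w, (∫ v in (·, w) ⁻¹' S, f v ∂ν₁) * g w ∂ν₂ := by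
  rw [← integral_indicator hS, integral_prod_symm _ ((hf.mul_prod hg).indicator hS)]
  simp only [indicator_prodMk_right_mul, integral_mul_const,
    integral_indicator (measurable_prodMk_right hS)]

end IntegrationByParts

section LinearOrder

variable {E ι 𝕜 : Type*} [LinearOrder E] [TopologicalSpace E] [OrderClosedTopology E]
  [SecondCountableTopology E] [MeasurableSpace E] [BorelSpace E] [RCLike 𝕜]
  {ν₁ ν₂ : Measure E} [SFinite ν₁] [SFinite ν₂] {f g : E → 𝕜}

lemma integrable_setIntegral_Iio_mul (hf : Integrable f ν₁) (hg : Integrable g ν₂) :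
    Integrable (fun w => (∫ v in Iio w, f v ∂ν₁) * g w) ν₂ :=
  integrable_setIntegral_section_mul (S := {z | z.1 < z.2})
    (measurableSet_lt measurable_fst measurable_snd) hf hg

lemma integrable_setIntegral_singleton_mul (hf : Integrable f ν₁) (hg : Integrable g ν₂) :
    Integrable (fun w => (∫ v in {w}, f v ∂ν₁) * g w) ν₂ :=
  integrable_setIntegral_section_mul (S := {z | z.1 = z.2}) measurableSet_diagonal hf hg

lemma integral_mul_integral_eq_add_integral_Iio (hf : Integrable f ν₁) (hg : Integrable g ν₂) :
    (∫ v, f v ∂ν₁) * (∫ w, g w ∂ν₂) = ∫ w, (∫ v in Iio w, f v ∂ν₁) * g w ∂ν₂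
      + ∫ v, f v * (∫ w in Iio v, g w ∂ν₂) ∂ν₁ + ∫ w, (∫ v in {w}, f v ∂ν₁) * g w ∂ν₂ := by
  have hlt : MeasurableSet {z : E × E | z.1 < z.2} := measurableSet_lt measurable_fst measurable_snd
  have hint := hf.mul_prod hg
  have hbelow : ∫ z in {z : E × E | z.1 < z.2}, f z.1 * g z.2 ∂ν₁.prod ν₂
      = ∫ w, (∫ v in Iio w, f v ∂ν₁) * g w ∂ν₂ :=
    setIntegral_prod_mul_eq_integral_section hlt hf hg
  have hdiag : ∫ z in diagonal E, f z.1 * g z.2 ∂ν₁.prod ν₂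
      = ∫ w, (∫ v in {w}, f v ∂ν₁) * g w ∂ν₂ :=
    setIntegral_prod_mul_eq_integral_section measurableSet_diagonal hf hg
  have habove : ∫ z in {z : E × E | z.2 < z.1}, f z.1 * g z.2 ∂ν₁.prod ν₂
      = ∫ v, f v * (∫ w in Iio v, g w ∂ν₂) ∂ν₁ := by
    simp_rw [mul_comm (f _)]
    exact ((Measure.measurePreserving_swap.setIntegral_preimage_emb
      MeasurableEquiv.prodComm.measurableEmbedding (fun z => g z.2 * f z.1)
      {z | z.2 < z.1}).symm).trans
      (setIntegral_prod_mul_eq_integral_section hlt hg hf)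
  have hcompl : {z : E × E | z.1 < z.2}ᶜ = {z | z.2 < z.1} ∪ diagonal E := by
    ext z
    simp [le_iff_lt_or_eq, eq_comm]
  have hdisjoint : Disjoint {z : E × E | z.2 < z.1} (diagonal E) :=
    disjoint_left.2 fun _ hlt heq => hlt.ne' heq
  rw [← integral_prod_mul, ← integral_add_compl hlt hint, hcompl,
    setIntegral_union hdisjoint measurableSet_diagonal hint.integrableOn hint.integrableOn,
    hbelow, habove, hdiag, add_assoc]

lemma sum_integral_mul_sum_integral [Fintype ι] {ν : ι → Measure E} [∀ j, SFinite (ν j)]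
    {f g : ι → E → 𝕜} (hf : ∀ j, Integrable (f j) (ν j)) (hg : ∀ j, Integrable (g j) (ν j)) :
    (∑ j, ∫ v, f j v ∂ν j) * (∑ l, ∫ w, g l w ∂ν l)
      = ∑ l, ∫ w, ((∑ j, ∫ v in Iio w, f j v ∂ν j) * g l w
        + f l w * (∑ j, ∫ v in Iio w, g j v ∂ν j)
        + (∑ j, ∫ v in {w}, f j v ∂ν j) * g l w) ∂ν l := by
  have hbelow (j l : ι) := integrable_setIntegral_Iio_mul (hf j) (hg l)
  have habove (j l : ι) : Integrable (fun w => f l w * ∫ v in Iio w, g j v ∂ν j) (ν l) := by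
    simpa only [mul_comm] using integrable_setIntegral_Iio_mul (hg j) (hf l)
  have hdiag (j l : ι) := integrable_setIntegral_singleton_mul (hf j) (hg l)
  have hsplit (l : ι) : ∫ w, ((∑ j, ∫ v in Iio w, f j v ∂ν j) * g l w
        + f l w * (∑ j, ∫ v in Iio w, g j v ∂ν j)
        + (∑ j, ∫ v in {w}, f j v ∂ν j) * g l w) ∂ν l
      = ∑ j, ∫ w, (∫ v in Iio w, f j v ∂ν j) * g l w ∂ν l
        + ∑ j, ∫ w, f l w * (∫ v in Iio w, g j v ∂ν j) ∂ν l
        + ∑ j, ∫ w, (∫ v in {w}, f j v ∂ν j) * g l w ∂ν l := by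
    rw [← integral_finsetSum _ fun j _ => hbelow j l, ← integral_finsetSum _ fun j _ => habove j l,
      ← integral_finsetSum _ fun j _ => hdiag j l,
      ← integral_add (integrable_finsetSum _ fun j _ => hbelow j l)
        (integrable_finsetSum _ fun j _ => habove j l),
      ← integral_add ?_ (integrable_finsetSum _ fun j _ => hdiag j l)]
    · simp only [Finset.sum_mul, Finset.mul_sum]
    · exact (integrable_finsetSum _ fun j _ => hbelow j l).add
        (integrable_finsetSum _ fun j _ => habove j l)
  simp_rw [hsplit, Finset.sum_mul_sum, integral_mul_integral_eq_add_integral_Iio (hf _) (hg _),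
    Finset.sum_add_distrib]
  rw [Finset.sum_comm, Finset.sum_comm (f := fun j l => ∫ w, (∫ v in {w}, f j v ∂ν j) * g l w ∂ν l)]

lemma sum_setIntegral_Iio_mul_sum_setIntegral_Iio [Fintype ι] {ν : ι → Measure E}
    [∀ j, SFinite (ν j)] {f g : ι → E → 𝕜} {t : E} (hf : ∀ j, IntegrableOn (f j) (Iio t) (ν j))
    (hg : ∀ j, IntegrableOn (g j) (Iio t) (ν j)) :
    (∑ j, ∫ v in Iio t, f j v ∂ν j) * (∑ l, ∫ w in Iio t, g l w ∂ν l)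
      = ∑ l, ∫ w in Iio t, ((∑ j, ∫ v in Iio w, f j v ∂ν j) * g l w
        + f l w * (∑ j, ∫ v in Iio w, g j v ∂ν j)
        + (∑ j, ∫ v in {w}, f j v ∂ν j) * g l w) ∂ν l := by
  rw [sum_integral_mul_sum_integral hf hg]
  refine Finset.sum_congr rfl fun l _ => setIntegral_congr_fun measurableSet_Iio fun w hw => ?_
  simp only [Measure.restrict_restrict measurableSet_Iio,
    Measure.restrict_restrict (measurableSet_singleton w),
    inter_eq_left.2 (Iio_subset_Iio (mem_Iio.1 hw).le),
    inter_eq_left.2 (singleton_subset_iff.2 hw)]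

end LinearOrder

section Counting

variable {Ω : Type*} {T : Fin 2 → Ω → Set ℝ} {j l : Fin 2} {ω : Ω} {w : ℝ}

lemma measurableSet_of_finite_inter_Icc {S : Set ℝ} (h : ∀ a b, (S ∩ Icc a b).Finite) :
    MeasurableSet S := by
  rw [← inter_univ S, ← iUnion_Icc_intCast ℝ, inter_iUnion]
  exact .iUnion fun k => (h _ _).measurableSet

lemma isLocallyFiniteMeasure_counting (h : ∀ a b, (T j ω ∩ Icc a b).Finite) :
    IsLocallyFiniteMeasure (counting T j ω) := by
  refine ⟨fun x => ⟨Icc (x - 1) (x + 1), Icc_mem_nhds (by linarith) (by linarith), ?_⟩⟩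
  rw [counting, Measure.restrict_apply measurableSet_Icc, inter_comm]
  exact Measure.count_apply_lt_top.2 (h _ _)

lemma setIntegral_singleton_counting (f : ℝ → ℝ) :
    ∫ v in {w}, f v ∂counting T j ω = (T j ω).indicator f w := by
  rw [integral_singleton, counting, measureReal_restrict_apply (measurableSet_singleton w)]
  by_cases hw : w ∈ T j ω <;> simp [hw, measureReal_def]

lemma sum_setIntegral_singleton_counting (hdisjoint : Disjoint (T 0 ω) (T 1 ω)) (hw : w ∈ T l ω)
    (f : Fin 2 → ℝ → ℝ) : ∑ j, ∫ v in {w}, f j v ∂counting T j ω = f l w := by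
  simp_rw [setIntegral_singleton_counting]
  refine (Finset.sum_eq_single l (fun j _ hj => indicator_of_notMem ?_ _) (by simp)).trans
    (indicator_of_mem hw _)
  fin_cases j <;> fin_cases l
  · exact absurd rfl hj
  · exact disjoint_right.1 hdisjoint hw
  · exact disjoint_left.1 hdisjoint hw
  · exact absurd rfl hj

end Counting

section Stacked

variable {Ω : Type*} {K : ℕ} {α : Fin K → Matrix (Fin 2) (Fin 2) ℝ} {β : Fin K → Fin 2 → ℝ}
  {T : Fin 2 → Ω → Set ℝ} {ω : Ω} {p q : Fin K × Fin 2} {t : ℝ}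

lemma kernel_add_apply (k : Fin K) (i j : Fin 2) (s t : ℝ) :
    kernel α β k (s + t) i j = Real.exp (-β k i * s) * kernel α β k t i j := by
  simp only [kernel, Matrix.hadamard_apply, Matrix.of_apply, mul_add, Real.exp_add]
  ring

lemma kernel_sub_apply_eq_stackedAlpha_mul (p : Fin K × Fin 2) (j : Fin 2) (t w : ℝ) :
    kernel α β p.1 (t - w) p.2 j = stackedAlpha α p j * Real.exp (-β p.1 p.2 * (t - w)) := rfl

lemma sum_setIntegral_Iio_kernel_eq_exp_mul_stacked (t w : ℝ) (ω : Ω) (p : Fin K × Fin 2) :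
    ∑ j, ∫ u in Iio w, kernel α β p.1 (t - u) p.2 j ∂counting T j ω
      = Real.exp (-β p.1 p.2 * (t - w)) * stacked α β T w ω p := by
  simp_rw [stacked, Finset.mul_sum, ← integral_const_mul, ← kernel_add_apply, sub_add_sub_cancel]

/-- The increment of the product `Λ_p Λ_q` at a jump of the `l`-th component, when the value of
`Λ` just before the jump is `x`. -/
def productJump (α : Fin K → Matrix (Fin 2) (Fin 2) ℝ) (p q : Fin K × Fin 2) (l : Fin 2)
    (x : Fin K × Fin 2 → ℝ) : ℝ :=
  (x p + stackedAlpha α p l) * (x q + stackedAlpha α q l) - x p * x q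

lemma stacked_mul_stacked_eq_sum_setIntegral_productJump
    (hfinite : ∀ j a b, (T j ω ∩ Icc a b).Finite) (hdisjoint : Disjoint (T 0 ω) (T 1 ω))
    (hp : ∀ j, IntegrableOn (fun u => kernel α β p.1 (t - u) p.2 j) (Iio t) (counting T j ω))
    (hq : ∀ j, IntegrableOn (fun u => kernel α β q.1 (t - u) q.2 j) (Iio t) (counting T j ω)) :
    stacked α β T t ω p * stacked α β T t ω q
      = ∑ l, ∫ w in Iio t, Real.exp (-(β p.1 p.2 + β q.1 q.2) * (t - w))
          * productJump α p q l (stacked α β T w ω) ∂counting T l ω := by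
  have (j : Fin 2) : IsLocallyFiniteMeasure (counting T j ω) :=
    isLocallyFiniteMeasure_counting (hfinite j)
  rw [stacked, stacked, sum_setIntegral_Iio_mul_sum_setIntegral_Iio hp hq]
  refine Finset.sum_congr rfl fun l _ => setIntegral_congr_ae measurableSet_Iio ?_
  have hjump : ∀ᵐ w ∂counting T l ω, w ∈ T l ω :=
    ae_restrict_mem (measurableSet_of_finite_inter_Icc (hfinite l))
  filter_upwards [hjump] with w hw _
  rw [sum_setIntegral_singleton_counting hdisjoint hw]
  simp_rw [sum_setIntegral_Iio_kernel_eq_exp_mul_stacked, kernel_sub_apply_eq_stackedAlpha_mul,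
    productJump, neg_add, add_mul, Real.exp_add]
  ring

end Stacked

section Intensity

variable {Ω F : Type*} {mΩ : MeasurableSpace Ω} {P : Measure Ω} {ν : Measure ℝ}
  {ℱ : Filtration ℝ mΩ} {n : Kernel Ω ℝ} {ρ : ℝ × Ω → ℝ≥0}

/-- The random measure `n` has the stochastic intensity `ρ` relative to the filtration `ℱ` and the
reference measure `ν`, that is, `ρ dν` is a compensator of `n`. -/
def HasIntensity (ℱ : Filtration ℝ mΩ) (P : Measure Ω) (n : Kernel Ω ℝ) (ν : Measure ℝ)
    (ρ : ℝ × Ω → ℝ≥0) : Prop :=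
  ∀ C : ℝ × Ω → ℝ≥0∞, Measurable[predictable ℱ] C →
    ∫⁻ ω, ∫⁻ t, C (t, ω) ∂n ω ∂P = ∫⁻ ω, ∫⁻ t, C (t, ω) * ρ (t, ω) ∂ν ∂P

variable [SFinite P] [SFinite ν] [IsSFiniteKernel n]

lemma HasIntensity.trim_predictable_eq (h : HasIntensity ℱ P n ν ρ) (hρ : Measurable ρ) :
    ((P ⊗ₘ n).map Prod.swap).trim (predictable_le_prod (ℱ := ℱ))
      = ((ν.prod P).withDensity fun z => ρ z).trim predictable_le_prod := by
  refine @Measure.ext _ (predictable ℱ) _ _ fun S hS => ?_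
  have hC' : Measurable[predictable ℱ] (S.indicator (1 : ℝ × Ω → ℝ≥0∞)) :=
    @Measurable.indicator _ _ S _ (predictable ℱ) _ _ (@measurable_const _ _ _ (predictable ℱ) 1)
      hS
  have hC : Measurable (S.indicator (1 : ℝ × Ω → ℝ≥0∞)) := hC'.mono predictable_le_prod le_rfl
  rw [trim_measurableSet_eq predictable_le_prod hS, trim_measurableSet_eq predictable_le_prod hS,
    ← lintegral_indicator_one (predictable_le_prod S hS), lintegral_map hC measurable_swap,
    Measure.lintegral_compProd (f := fun z => S.indicator 1 z.swap) (hC.comp measurable_swap),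
    ← lintegral_indicator_one (predictable_le_prod S hS),
    lintegral_withDensity_eq_lintegral_mul _ (by fun_prop) hC, lintegral_prod_symm' _ (by fun_prop)]
  simpa only [Prod.swap_prod_mk, Pi.mul_apply, mul_comm] using h _ hC'

variable [NormedAddCommGroup F] [NormedSpace ℝ F] {G : ℝ × Ω → F}

lemma HasIntensity.integrable_compProd (h : HasIntensity ℱ P n ν ρ) (hρ : Measurable ρ)
    (hG : StronglyMeasurable[predictable ℱ] G) (hint : Integrable (fun z => ρ z • G z) (ν.prod P)) :
    Integrable (fun z : Ω × ℝ => G z.swap) (P ⊗ₘ n) := by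
  have hdensity : Integrable G ((ν.prod P).withDensity fun z => ρ z) :=
    (integrable_withDensity_iff_integrable_smul hρ).2 hint
  have htrim := hdensity.trim predictable_le_prod hG
  rw [← h.trim_predictable_eq hρ] at htrim
  exact (integrable_of_integrable_trim predictable_le_prod htrim).comp_measurable measurable_swap

lemma HasIntensity.integral_integral_eq (h : HasIntensity ℱ P n ν ρ) (hρ : Measurable ρ)
    (hG : StronglyMeasurable[predictable ℱ] G) (hint : Integrable (fun z => ρ z • G z) (ν.prod P)) :
    ∫ ω, ∫ t, G (t, ω) ∂n ω ∂P = ∫ z, ρ z • G z ∂ν.prod P := by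
  calc ∫ ω, ∫ t, G (t, ω) ∂n ω ∂P
      = ∫ z, G z.swap ∂(P ⊗ₘ n) :=
        (Measure.integral_compProd (h.integrable_compProd hρ hG hint)).symm
    _ = ∫ z, G z ∂(P ⊗ₘ n).map Prod.swap :=
        (integral_map measurable_swap.aemeasurable
          (hG.mono predictable_le_prod).aestronglyMeasurable).symm
    _ = ∫ z, G z ∂(ν.prod P).withDensity fun z => ρ z := by
        rw [integral_trim predictable_le_prod hG, h.trim_predictable_eq hρ,
          ← integral_trim predictable_le_prod hG]
    _ = ∫ z, ρ z • G z ∂ν.prod P := integral_withDensity_eq_integral_smul hρ G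

end Intensity

section Stationary

variable {Ω E : Type*} {mΩ : MeasurableSpace Ω} {mE : MeasurableSpace E} {P : Measure Ω} [SFinite P]
  {ν : Measure E} {Y : E → Ω → ℝ} {Y₀ : Ω → ℝ} {e : E → ℝ}

lemma integrable_mul_of_identDistrib (hY : Measurable fun z : E × Ω => Y z.1 z.2)
    (hident : ∀ w, IdentDistrib (Y w) Y₀ P P) (he : Integrable e ν) (hY₀ : Integrable Y₀ P) :
    Integrable (fun z : E × Ω => e z.1 * Y z.1 z.2) (ν.prod P) := by
  have hmeas : AEStronglyMeasurable (fun z : E × Ω => e z.1 * Y z.1 z.2) (ν.prod P) :=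
    he.1.comp_fst.mul hY.aestronglyMeasurable
  refine (integrable_prod_iff hmeas).2
    ⟨.of_forall fun w => ((hident w).integrable_iff.2 hY₀).const_mul (e w), ?_⟩
  have hnorm (w : E) : ∫ ω, ‖Y w ω‖ ∂P = ∫ ω, ‖Y₀ ω‖ ∂P := (hident w).norm.integral_eq
  simp_rw [norm_mul, integral_const_mul, hnorm]
  exact he.norm.mul_const _

lemma integral_mul_eq_of_identDistrib [SFinite ν] (hY : Measurable fun z : E × Ω => Y z.1 z.2)
    (hident : ∀ w, IdentDistrib (Y w) Y₀ P P) (he : Integrable e ν) (hY₀ : Integrable Y₀ P) :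
    ∫ z : E × Ω, e z.1 * Y z.1 z.2 ∂ν.prod P = (∫ w, e w ∂ν) * ∫ ω, Y₀ ω ∂P := by
  rw [integral_prod _ (integrable_mul_of_identDistrib hY hident he hY₀)]
  simp_rw [integral_const_mul, fun w => (hident w).integral_eq, integral_mul_const]

end Stationary

section Exponential

variable {γ : ℝ}

lemma integrableOn_exp_neg_mul_sub_Iio (hγ : 0 < γ) (t : ℝ) :
    IntegrableOn (fun w => Real.exp (-γ * (t - w))) (Iio t) := by
  simp_rw [mul_sub, neg_mul, sub_neg_eq_add, Real.exp_add]
  exact ((integrableOn_exp_mul_Iic hγ t).mono_set Iio_subset_Iic_self).const_mul _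

lemma setIntegral_Iio_exp_neg_mul_sub (hγ : 0 < γ) (t : ℝ) :
    ∫ w in Iio t, Real.exp (-γ * (t - w)) = γ⁻¹ := by
  simp_rw [mul_sub, neg_mul, sub_neg_eq_add, Real.exp_add]
  rw [integral_const_mul, setIntegral_congr_set Iio_ae_eq_Iic, integral_exp_mul_Iic hγ,
    mul_div_assoc', ← Real.exp_add, neg_add_cancel, Real.exp_zero, one_div]

end Exponential

section Hawkes

variable {Ω : Type*} {mΩ : MeasurableSpace Ω} {P : Measure Ω} {ℱ : Filtration ℝ mΩ} {K : ℕ}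
  {μ : Fin 2 → ℝ} {α : Fin K → Matrix (Fin 2) (Fin 2) ℝ} {β : Fin K → Fin 2 → ℝ}
  {T : Fin 2 → Ω → Set ℝ}

lemma setIntegral_Iio_kernel_eq_mul_toReal_lintegral (k : Fin K) (i j : Fin 2) (t : ℝ) (ω : Ω) :
    ∫ u in Iio t, kernel α β k (t - u) i j ∂counting T j ω
      = Real.exp (-β k i * t) * (α k i j
        * (∫⁻ u in Iio t, ENNReal.ofReal (Real.exp (β k i * u)) ∂counting T j ω).toReal) := by
  rw [← integral_eq_lintegral_of_nonneg_ae (.of_forall fun _ => (Real.exp_pos _).le)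
    (by fun_prop), ← integral_const_mul, ← integral_const_mul]
  simp_rw [sub_eq_add_neg t, kernel_add_apply]
  simp only [kernel, Matrix.hadamard_apply, Matrix.of_apply, neg_mul_neg]

lemma IsHawkes.isLocallyFiniteMeasure_counting (hT : IsHawkes P ℱ μ α β T) (j : Fin 2) (ω : Ω) :
    IsLocallyFiniteMeasure (counting T j ω) :=
  MultiKernelHawkes.isLocallyFiniteMeasure_counting (hT.locallyFinite j ω)

lemma IsHawkes.measurable_stacked_predictable (hT : IsHawkes P ℱ μ α β T) :
    Measurable[predictable ℱ] fun z : ℝ × Ω => stacked α β T z.1 z.2 := by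
  have := hT.isLocallyFiniteMeasure_counting
  refine @measurable_pi_lambda _ _ _ (predictable ℱ) _ _ fun p =>
    Finset.measurable_fun_sum _ fun j _ => ?_
  simp_rw [setIntegral_Iio_kernel_eq_mul_toReal_lintegral]
  have hexp : Measurable fun t : ℝ => Real.exp (-β p.1 p.2 * t) := by fun_prop
  exact (hexp.comp measurable_fst_predictable).mul
    ((measurable_setLIntegral_Iio_predictable (hT.adapted j) (by fun_prop)).ennreal_toReal.const_mul
      _)

lemma IsHawkes.measurable_stacked (hT : IsHawkes P ℱ μ α β T) :
    Measurable fun z : ℝ × Ω => stacked α β T z.1 z.2 :=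
  hT.measurable_stacked_predictable.mono predictable_le_prod le_rfl

/-- The random measure `dN_j` of the jumps of the `j`-th component. -/
noncomputable def IsHawkes.jumpKernel (hT : IsHawkes P ℱ μ α β T) (j : Fin 2) : Kernel Ω ℝ where
  toFun := counting T j
  measurable' :=
    have := hT.isLocallyFiniteMeasure_counting j
    measurable_measure_of_measurable_Ioc fun s r => (hT.adapted j s r).mono (ℱ.le r) le_rfl

lemma IsHawkes.isSFiniteKernel_jumpKernel (hT : IsHawkes P ℱ μ α β T) (j : Fin 2) :
    IsSFiniteKernel (hT.jumpKernel j) :=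
  have (ω : Ω) : IsLocallyFiniteMeasure (hT.jumpKernel j ω) :=
    hT.isLocallyFiniteMeasure_counting j ω
  isSFiniteKernel_of_isLocallyFiniteMeasure _

lemma IsHawkes.hasIntensity_jumpKernel (hT : IsHawkes P ℱ μ α β T) (j : Fin 2) :
    HasIntensity ℱ P (hT.jumpKernel j) volume
      fun z => (intensity μ α β T z.1 z.2 j).toNNReal :=
  hT.isIntensity j

lemma IsHawkes.measurable_intensity (hT : IsHawkes P ℱ μ α β T) (j : Fin 2) :
    Measurable fun z : ℝ × Ω => intensity μ α β T z.1 z.2 j :=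
  measurable_const.add (Finset.measurable_fun_sum _ fun k _ =>
    (measurable_pi_apply (k, j)).comp hT.measurable_stacked)

lemma IsHawkes.toNNReal_intensity_smul_ae_eq (hT : IsHawkes P ℱ μ α β T) (l : Fin 2)
    (g : ℝ × Ω → ℝ) :
    (fun z => (intensity μ α β T z.1 z.2 l).toNNReal • g z)
      =ᵐ[volume.prod P] fun z => intensity μ α β T z.1 z.2 l * g z := by
  filter_upwards [Measure.quasiMeasurePreserving_snd.ae hT.nonneg] with z hz
  rw [NNReal.smul_def, Real.coe_toNNReal _ (hz z.1 l), smul_eq_mul]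

section SteadyState

variable [SFinite P] {γ t : ℝ} {l : Fin 2} {f : (Fin K × Fin 2 → ℝ) → ℝ} {e : ℝ → ℝ}

lemma IsHawkes.integral_integral_counting_eq (hT : IsHawkes P ℱ μ α β T)
    (hsteady : IsSteadyState P α β T) (he : Measurable e) (he' : Integrable e) (hf : Measurable f)
    (hint : Integrable (fun ω => f (stacked α β T t ω) * intensity μ α β T t ω l) P) :
    Integrable (fun ω => ∫ w, e w * f (stacked α β T w ω) ∂counting T l ω) P
      ∧ ∫ ω, ∫ w, e w * f (stacked α β T w ω) ∂counting T l ω ∂P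
        = (∫ w, e w) * ∫ ω, f (stacked α β T t ω) * intensity μ α β T t ω l ∂P := by
  have := hT.isSFiniteKernel_jumpKernel l
  let Y (w : ℝ) (ω : Ω) : ℝ := f (stacked α β T w ω) * intensity μ α β T w ω l
  have hY : Measurable fun z : ℝ × Ω => Y z.1 z.2 :=
    (hf.comp hT.measurable_stacked).mul (hT.measurable_intensity l)
  have hident (w : ℝ) : IdentDistrib (Y w) (Y t) P P :=
    ((hsteady w).trans (hsteady t).symm).comp
      (u := fun x => f x * (μ l + ∑ k, x (k, l))) (by fun_prop)
  have hG : StronglyMeasurable[predictable ℱ]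
      fun z : ℝ × Ω => e z.1 * f (stacked α β T z.1 z.2) :=
    ((he.comp measurable_fst_predictable).mul
      (hf.comp hT.measurable_stacked_predictable)).stronglyMeasurable
  have hsmul : (fun z : ℝ × Ω => (intensity μ α β T z.1 z.2 l).toNNReal
      • (e z.1 * f (stacked α β T z.1 z.2))) =ᵐ[volume.prod P] fun z => e z.1 * Y z.1 z.2 := by
    filter_upwards [hT.toNNReal_intensity_smul_ae_eq l _] with z hz
    rw [hz]
    ring
  have hint' := (integrable_mul_of_identDistrib hY hident he' hint).congr hsmul.symm
  have hρ : Measurable fun z : ℝ × Ω => (intensity μ α β T z.1 z.2 l).toNNReal :=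
    (hT.measurable_intensity l).real_toNNReal
  refine ⟨Integrable.integral_compProd
      ((hT.hasIntensity_jumpKernel l).integrable_compProd hρ hG hint'),
    ((hT.hasIntensity_jumpKernel l).integral_integral_eq hρ hG hint').trans ?_⟩
  rw [integral_congr_ae hsmul, integral_mul_eq_of_identDistrib hY hident he' hint]

lemma IsHawkes.integral_setIntegral_exp_mul_counting_eq (hT : IsHawkes P ℱ μ α β T)
    (hsteady : IsSteadyState P α β T) (hγ : 0 < γ) (hf : Measurable f)
    (hint : Integrable (fun ω => f (stacked α β T t ω) * intensity μ α β T t ω l) P) :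
    Integrable (fun ω => ∫ w in Iio t, Real.exp (-γ * (t - w)) * f (stacked α β T w ω)
        ∂counting T l ω) P
      ∧ ∫ ω, ∫ w in Iio t, Real.exp (-γ * (t - w)) * f (stacked α β T w ω) ∂counting T l ω ∂P
        = γ⁻¹ * ∫ ω, f (stacked α β T t ω) * intensity μ α β T t ω l ∂P := by
  simp_rw [← integral_indicator measurableSet_Iio, indicator_mul_left]
  rw [← setIntegral_Iio_exp_neg_mul_sub hγ t, ← integral_indicator measurableSet_Iio]
  exact hT.integral_integral_counting_eq hsteady
    (Measurable.indicator (by fun_prop) measurableSet_Iio)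
    ((integrableOn_exp_neg_mul_sub_Iio hγ t).integrable_indicator measurableSet_Iio) hf hint

end SteadyState

end Hawkes

section CrossMoment

variable {Ω ι κ : Type*} {mΩ : MeasurableSpace Ω} {P : Measure Ω} {X : Ω → ι → ℝ}

/-- The matrix `E[X Yᵀ]`, for which the second moment matrix of `X` is the case `Y = X`. -/
noncomputable def crossMoment (P : Measure Ω) (X : Ω → ι → ℝ) (Y : Ω → κ → ℝ) : Matrix ι κ ℝ :=
  Matrix.of fun p l => ∫ ω, X ω p * Y ω l ∂P

lemma transpose_secondMoment (P : Measure Ω) (X : Ω → ι → ℝ) :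
    (secondMoment P X)ᵀ = secondMoment P X := by
  ext p q
  simp only [Matrix.transpose_apply, secondMoment, Matrix.of_apply, mul_comm]

variable [IsFiniteMeasure P] [Fintype ι]

lemma memLp_add_mulVec (hX : ∀ p, MemLp (fun ω => X ω p) 2 P) (c : κ → ℝ) (A : Matrix κ ι ℝ)
    (l : κ) : MemLp (fun ω => (c + A *ᵥ X ω) l) 2 P :=
  (memLp_const (c l)).add (memLp_finsetSum _ fun q _ => (hX q).const_mul (A l q))

lemma crossMoment_add_mulVec (hX : ∀ p, MemLp (fun ω => X ω p) 2 P) (c : κ → ℝ)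
    (A : Matrix κ ι ℝ) :
    crossMoment P X (fun ω => c + A *ᵥ X ω)
      = Matrix.vecMulVec (mean P X) c + secondMoment P X * Aᵀ := by
  ext p l
  have hterm (q : ι) : Integrable (fun ω => X ω p * X ω q * A l q) P :=
    ((hX p).integrable_mul (hX q)).mul_const _
  simp only [crossMoment, secondMoment, mean, Matrix.of_apply, Matrix.add_apply, Pi.add_apply,
    Matrix.vecMulVec_apply, Matrix.mul_apply, Matrix.transpose_apply, Matrix.mulVec, dotProduct,
    ← integral_mul_const]
  rw [← integral_finsetSum _ fun q _ => hterm q, ← integral_add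
    (((hX p).integrable one_le_two).mul_const _) (integrable_finsetSum _ fun q _ => hterm q)]
  simp only [mul_add, Finset.mul_sum, mul_comm (A l _), mul_assoc]

end CrossMoment

section Sylvester

variable {Ω : Type*} {mΩ : MeasurableSpace Ω} {P : Measure Ω} {ℱ : Filtration ℝ mΩ} {K : ℕ}
  {μ : Fin 2 → ℝ} {α : Fin K → Matrix (Fin 2) (Fin 2) ℝ} {β : Fin K → Fin 2 → ℝ}
  {T : Fin 2 → Ω → Set ℝ} {t : ℝ} {X : Ω → Fin K × Fin 2 → ℝ} {Y : Ω → Fin 2 → ℝ}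
  {p q : Fin K × Fin 2} {l : Fin 2}

lemma measurable_productJump (α : Fin K → Matrix (Fin 2) (Fin 2) ℝ) (p q : Fin K × Fin 2)
    (l : Fin 2) : Measurable (productJump α p q l) := by
  unfold productJump
  fun_prop

lemma productJump_mul (x : Fin K × Fin 2 → ℝ) (y : ℝ) :
    productJump α p q l x * y = x p * y * stackedAlpha α q l + stackedAlpha α p l * (x q * y)
      + stackedAlpha α p l * y * stackedAlpha α q l := by
  rw [productJump]
  ring

lemma integrable_productJump_mul (hp : Integrable (fun ω => X ω p * Y ω l) P)
    (hq : Integrable (fun ω => X ω q * Y ω l) P) (hY : Integrable (fun ω => Y ω l) P) :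
    Integrable (fun ω => productJump α p q l (X ω) * Y ω l) P := by
  simp_rw [productJump_mul]
  exact ((hp.mul_const _).add (hq.const_mul _)).add ((hY.const_mul _).mul_const _)

lemma integral_productJump_mul (hp : Integrable (fun ω => X ω p * Y ω l) P)
    (hq : Integrable (fun ω => X ω q * Y ω l) P) (hY : Integrable (fun ω => Y ω l) P) :
    ∫ ω, productJump α p q l (X ω) * Y ω l ∂P
      = crossMoment P X Y p l * stackedAlpha α q l + stackedAlpha α p l * crossMoment P X Y q l
        + stackedAlpha α p l * mean P Y l * stackedAlpha α q l := by
  simp_rw [productJump_mul]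
  rw [integral_add ((hp.mul_const _).fun_add (hq.const_mul _)) ((hY.const_mul _).mul_const _),
    integral_add (hp.mul_const _) (hq.const_mul _), integral_mul_const, integral_const_mul,
    integral_mul_const, integral_const_mul]
  rfl

lemma intensity_eq_add_matJ_mulVec (t : ℝ) (ω : Ω) :
    intensity μ α β T t ω = μ + matJ K *ᵥ stacked α β T t ω := by
  ext i
  simp [intensity, matJ, Matrix.mulVec, dotProduct, Fintype.sum_prod_type]

lemma IsHawkes.ae_stacked_mul_stacked_eq (hT : IsHawkes P ℱ μ α β T) (t : ℝ)
    (p q : Fin K × Fin 2) :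
    ∀ᵐ ω ∂P, stacked α β T t ω p * stacked α β T t ω q
      = ∑ l, ∫ w in Iio t, Real.exp (-(β p.1 p.2 + β q.1 q.2) * (t - w))
          * productJump α p q l (stacked α β T w ω) ∂counting T l ω := by
  filter_upwards [hT.noCommonJumps, hT.integrable] with ω hdisjoint hint
  exact stacked_mul_stacked_eq_sum_setIntegral_productJump (hT.locallyFinite · ω) hdisjoint
    (hint t _ _) (hint t _ _)

lemma IsHawkes.add_mul_secondMoment_apply [SFinite P] (hT : IsHawkes P ℱ μ α β T)
    (hsteady : IsSteadyState P α β T) (hβ : 0 < β p.1 p.2 + β q.1 q.2)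
    (hint : ∀ l, Integrable
      (fun ω => productJump α p q l (stacked α β T t ω) * intensity μ α β T t ω l) P) :
    (β p.1 p.2 + β q.1 q.2) * secondMoment P (stacked α β T t) p q
      = ∑ l, ∫ ω, productJump α p q l (stacked α β T t ω) * intensity μ α β T t ω l ∂P := by
  have hcampbell (l : Fin 2) := hT.integral_setIntegral_exp_mul_counting_eq hsteady hβ
    (measurable_productJump α p q l) (hint l)
  rw [secondMoment, Matrix.of_apply, integral_congr_ae (hT.ae_stacked_mul_stacked_eq t p q),
    integral_finsetSum _ fun l _ => (hcampbell l).1, Finset.mul_sum]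
  simp_rw [fun l => (hcampbell l).2, mul_inv_cancel_left₀ hβ.ne']

variable [IsFiniteMeasure P]

lemma IsHawkes.stackedBeta_mul_add_mul_stackedBeta (hT : IsHawkes P ℱ μ α β T)
    (hsteady : IsSteadyState P α β T) (hβ : ∀ k i, 0 < β k i)
    (hmoment : ∀ p, MemLp (fun ω => stacked α β T t ω p) 2 P) :
    stackedBeta β * secondMoment P (stacked α β T t)
        + secondMoment P (stacked α β T t) * stackedBeta β
      = crossMoment P (stacked α β T t) (intensity μ α β T t) * (stackedAlpha α)ᵀ
        + stackedAlpha α * (crossMoment P (stacked α β T t) (intensity μ α β T t))ᵀ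
        + stackedAlpha α * Matrix.diagonal (mean P (intensity μ α β T t)) * (stackedAlpha α)ᵀ := by
  have hintensity (l : Fin 2) : MemLp (fun ω => intensity μ α β T t ω l) 2 P := by
    simp_rw [intensity_eq_add_matJ_mulVec]
    exact memLp_add_mulVec hmoment μ (matJ K) l
  have hcross (p : Fin K × Fin 2) (l : Fin 2) :
      Integrable (fun ω => stacked α β T t ω p * intensity μ α β T t ω l) P :=
    (hmoment p).integrable_mul (hintensity l)
  have hmean (l : Fin 2) := (hintensity l).integrable one_le_two
  ext p q
  have hentry := hT.add_mul_secondMoment_apply hsteady (p := p) (q := q)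
    (add_pos (hβ _ _) (hβ _ _))
    fun l => integrable_productJump_mul (hcross p l) (hcross q l) (hmean l)
  simp_rw [fun l => integral_productJump_mul (α := α) (hcross p l) (hcross q l) (hmean l),
    Finset.sum_add_distrib, add_mul, mul_comm (β q.1 q.2)] at hentry
  simpa only [stackedBeta, Matrix.add_apply, Matrix.diagonal_mul, Matrix.mul_diagonal,
    Matrix.mul_apply (N := (stackedAlpha α)ᵀ), Matrix.mul_apply (N := (crossMoment _ _ _)ᵀ),
    Matrix.transpose_apply] using hentry

lemma IsHawkes.sylvester (hT : IsHawkes P ℱ μ α β T) (hsteady : IsSteadyState P α β T)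
    (hβ : ∀ k i, 0 < β k i) (hmoment : ∀ p, MemLp (fun ω => stacked α β T t ω p) 2 P) :
    (stackedBeta β - stackedAlpha α * matJ K) * secondMoment P (stacked α β T t)
        + secondMoment P (stacked α β T t) * (stackedBeta β - (matJ K)ᵀ * (stackedAlpha α)ᵀ)
      = rhs P μ α β T t := by
  have hcross : crossMoment P (stacked α β T t) (intensity μ α β T t)
      = Matrix.vecMulVec (mean P (stacked α β T t)) μ
        + secondMoment P (stacked α β T t) * (matJ K)ᵀ := by
    rw [← crossMoment_add_mulVec hmoment]
    congr with ω : 1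
    exact intensity_eq_add_matJ_mulVec t ω
  rw [sub_mul, mul_sub, sub_add_sub_comm,
    hT.stackedBeta_mul_add_mul_stackedBeta hsteady hβ hmoment, hcross, Matrix.transpose_add,
    Matrix.transpose_vecMulVec, Matrix.transpose_mul, transpose_secondMoment,
    Matrix.transpose_transpose, rhs, Matrix.add_mul, Matrix.mul_add,
    Matrix.mul_assoc (secondMoment _ _), ← Matrix.mul_assoc (stackedAlpha α) (matJ K)]
  abel

lemma transpose_stackedBeta_sub (α : Fin K → Matrix (Fin 2) (Fin 2) ℝ) (β : Fin K → Fin 2 → ℝ) :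
    (stackedBeta β - stackedAlpha α * matJ K)ᵀ
      = stackedBeta β - (matJ K)ᵀ * (stackedAlpha α)ᵀ := by
  rw [Matrix.transpose_sub, Matrix.transpose_mul, stackedBeta, Matrix.diagonal_transpose]

end Sylvester

lemma kronecker_add_kronecker_mulVec_vec {ι R : Type*} [Fintype ι] [DecidableEq ι]
    [CommSemiring R] (A X : Matrix ι ι R) :
    ((1 : Matrix ι ι R) ⊗ₖ A + A ⊗ₖ 1) *ᵥ Matrix.vec X = Matrix.vec (A * X + X * Aᵀ) := by
  rw [Matrix.add_mulVec, Matrix.kronecker_mulVec_vec, Matrix.kronecker_mulVec_vec, Matrix.vec_add,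
    Matrix.transpose_one, Matrix.mul_one, Matrix.one_mul]

end MultiKernelHawkes

open MultiKernelHawkes in
theorem proposition2 {Ω : Type*} {m : MeasurableSpace Ω} (P : Measure Ω) [IsProbabilityMeasure P]
    (ℱ : Filtration ℝ m) (K : ℕ) (μ : Fin 2 → ℝ) (α : Fin K → Matrix (Fin 2) (Fin 2) ℝ)
    (β : Fin K → Fin 2 → ℝ) (hβ : ∀ k i, 0 < β k i) (T : Fin 2 → Ω → Set ℝ)
    (hT : IsHawkes P ℱ μ α β T) (hsteady : IsSteadyState P α β T) (t : ℝ)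
    (hmoment : ∀ p, MemLp (fun ω => stacked α β T t ω p) 2 P) :
    (stackedBeta β - stackedAlpha α * matJ K) * secondMoment P (stacked α β T t)
        + secondMoment P (stacked α β T t) * (stackedBeta β - (matJ K)ᵀ * (stackedAlpha α)ᵀ)
      = rhs P μ α β T t
    ∧ (((1 : Matrix (Fin K × Fin 2) (Fin K × Fin 2) ℝ) ⊗ₖ (stackedBeta β - stackedAlpha α * matJ K)
        + (stackedBeta β - stackedAlpha α * matJ K) ⊗ₖ 1) *ᵥ
          Matrix.vec (secondMoment P (stacked α β T t))
      = Matrix.vec (rhs P μ α β T t))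
    ∧ ∀ X : Matrix (Fin K × Fin 2) (Fin K × Fin 2) ℝ,
      ((stackedBeta β - stackedAlpha α * matJ K) * X
          + X * (stackedBeta β - (matJ K)ᵀ * (stackedAlpha α)ᵀ) = rhs P μ α β T t
        ↔ ((1 : Matrix (Fin K × Fin 2) (Fin K × Fin 2) ℝ) ⊗ₖ
              (stackedBeta β - stackedAlpha α * matJ K)
            + (stackedBeta β - stackedAlpha α * matJ K) ⊗ₖ 1) *ᵥ Matrix.vec X
          = Matrix.vec (rhs P μ α β T t)) := by
  have hvec (X : Matrix (Fin K × Fin 2) (Fin K × Fin 2) ℝ) :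
      (stackedBeta β - stackedAlpha α * matJ K) * X
          + X * (stackedBeta β - (matJ K)ᵀ * (stackedAlpha α)ᵀ) = rhs P μ α β T t
        ↔ ((1 : Matrix (Fin K × Fin 2) (Fin K × Fin 2) ℝ) ⊗ₖ
              (stackedBeta β - stackedAlpha α * matJ K)
            + (stackedBeta β - stackedAlpha α * matJ K) ⊗ₖ 1) *ᵥ Matrix.vec X
          = Matrix.vec (rhs P μ α β T t) := by
    rw [kronecker_add_kronecker_mulVec_vec, transpose_stackedBeta_sub, Matrix.vec_inj]
  have hsylvester := hT.sylvester hsteady hβ hmoment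
  exact ⟨hsylvester, (hvec _).1 hsylvester, hvec⟩
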